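/- Lemma (2D variance). Let $N\ge 1$, $\sigma_t>0$, let $\tau$ be a real time-of-arrival function, differentiable at the midpoints $\mathbf x_{m,n}=\big(\tfrac{2m+1}{2N},\tfrac{2n+1}{2N}\big)$, $0\le m,n<N$, of the pixels $P_{m,n}=[\tfrac mN,\tfrac{m+1}N]\times[\tfrac nN,\tfrac{n+1}N]$ of the unit square. Put $\mathbf c_{m,n}=\nabla\tau(\mathbf x_{m,n})$, $\|\mathbf c\|^2=\frac1{N^2}\sum_{m,n}\|\mathbf c_{m,n}\|^2$ and $\sigma_s=1/(\sqrt{12}\,N)$, and let $\alpha_0>0$ be the total flux over the unit square, so that each pixel has flux $\alpha=\alpha_0/N^2$. Model. With $\mathcal N(t\,|\,\mu,\sigma^2)$ the Gaussian density, and with no noise floor, the return pulse of pixel $(m,n)$ when its time of arrival is $\theta$ is obtained by smoothing the space-time intensity of the linearised $\tau$ with a 2D Gaussian kernel and evaluating at the midpoint: $$\lambda_{m,n}(t;\theta)=\int_{\mathbb R^2}\mathcal N(\mathbf x_{m,n}-\mathbf u\,|\,0,\sigma_s^2 I)\;\alpha\,\mathcal N\big(t\,\big|\,\theta+\mathbf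 c_{m,n}^T(\mathbf u-\mathbf x_{m,n}),\sigma_t^2\big)\,d\mathbf u .$$ The pixels record independent Poisson processes of time stamps $t_1,\dots,t_M$ on $\mathbb R$, with intensities $\lambda_{m,n}(\cdot\,;\tau(\mathbf x_{m,n}))$. The log-likelihood of a record is $\mathcal L_{m,n}(\theta)=\sum_{j=1}^M\log\lambda_{m,n}(t_j;\theta)$, and an ML estimate is a maximiser of it over $\theta\in\mathbb R$. Let $\overline\tau$ be the piecewise constant function whose value on $P_{m,n}$ is the average over $P_{m,n}$ of the linearised function $\tau(\mathbf x_{m,n})+\mathbf c_{m,n}^T(\mathbf x-\mathbf x_{m,n})$. For estimates $\widehat\tau_{m,n}$, each computed from the record of its own pixel, let $\widehat\tau$ be the piecewise constant function with the value $\widehat\tau_{m,n}$ on $P_{m,n}$, and let $$\mathrm{Var}=\mathbb E\Big[\int_{[0,1]^2}\big(\widehat\tau(\mathbf x)-\overline\tau(\mathbf x)\big)^2d\mathbf x\Big].$$ Then: 1. For every $\alpha_0>0$, if $\widehat\tau_{m,n}$ is the first-order expansion of the ML estimate at the true value, $\widehat\tau_{m,n}=\tau(\mathbf x_{m,n})-\mathcal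 L_{m,n}'(\tau(\mathbf x_{m,n}))\,/\,\mathbb E\big[\mathcal L_{m,n}''(\tau(\mathbf x_{m,n}))\big]$, then exactly $$\mathrm{Var}=\frac{N^2}{\alpha_0}\big(\|\mathbf c\|^2\sigma_s^2+\sigma_t^2\big).$$ 2. For every $\alpha_0>0$, every pixel and every record with $M\ge1$ time stamps, the ML estimate exists and is unique. 3. If $\widehat\tau_{m,n}$ is the ML estimate itself (for records with $M=0$, any value whose absolute value is at most a constant $B$ independent of $\alpha_0$), then the same formula holds asymptotically for large flux: with $N$, $\sigma_t$ and $\tau$ fixed, $$\mathrm{Var}\Big/\Big(\frac{N^2}{\alpha_0}\big(\|\mathbf c\|^2\sigma_s^2+\sigma_t^2\big)\Big)\longrightarrow 1\qquad(\alpha_0\to\infty).$$ -/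

import Mathlib

open MeasureTheory ProbabilityTheory Filter Topology

noncomputable section

namespace SpadLidar

/-! Geometry of the pixel grid: `N × N` pixels on the unit square. -/

/-- The plane, with its Euclidean norm. -/
abbrev Plane : Type := EuclideanSpace ℝ (Fin 2)

/-- The unit square `[0,1] × [0,1]`. -/
def unitSquare : Set Plane := {x | ∀ i, x i ∈ Set.Icc (0 : ℝ) 1}

/-- The boxcar function, `1` on `[0,1]` and `0` elsewhere. -/
def boxcar (x : ℝ) : ℝ := (Set.Icc (0 : ℝ) 1).indicator (fun _ => 1) x

/-- The window `φ(N x - m) φ(N y - n)` of the pixel `p = (m, n)`. -/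
def pixelWindow (N : ℕ) (p : Fin N × Fin N) (x : Plane) : ℝ :=
  boxcar ((N : ℝ) * x 0 - ((p.1 : ℕ) : ℝ)) * boxcar ((N : ℝ) * x 1 - ((p.2 : ℕ) : ℝ))

/-- The pixel `[m/N, (m+1)/N] × [n/N, (n+1)/N]`. -/
def pixel (N : ℕ) (p : Fin N × Fin N) : Set Plane :=
  {x | x 0 ∈ Set.Icc (((p.1 : ℕ) : ℝ) / N) ((((p.1 : ℕ) : ℝ) + 1) / N) ∧
       x 1 ∈ Set.Icc (((p.2 : ℕ) : ℝ) / N) ((((p.2 : ℕ) : ℝ) + 1) / N)}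

/-- The mid-point `((2m+1)/(2N), (2n+1)/(2N))` of a pixel. -/
def center (N : ℕ) (p : Fin N × Fin N) : Plane :=
  !₂[(2 * ((p.1 : ℕ) : ℝ) + 1) / (2 * N), (2 * ((p.2 : ℕ) : ℝ) + 1) / (2 * N)]

/-- The piecewise constant function with the value `v p` on the pixel `p`. -/
def piecewiseConstant (N : ℕ) (v : Fin N × Fin N → ℝ) (x : Plane) : ℝ :=
  ∑ p, v p * pixelWindow N p x

/-! The time of arrival function and its linearisation. -/

/-- The gradient `c_p = ∇τ(x_p)` at the mid-point of the pixel `p`. -/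
def pixelGradient (N : ℕ) (τ : Plane → ℝ) (p : Fin N × Fin N) : Plane :=
  gradient τ (center N p)

/-- The piecewise linear approximation of `τ`: on the pixel `p` it is
`τ(x_p) + c_pᵀ (x - x_p)`. -/
def linearised (N : ℕ) (τ : Plane → ℝ) (x : Plane) : ℝ :=
  ∑ p, (τ (center N p) + inner ℝ (pixelGradient N τ p) (x - center N p)) * pixelWindow N p x

/-- The average over the pixel `p` (of area `1 / N ^ 2`) of the linearised `τ`. -/
def pixelMean (N : ℕ) (τ : Plane → ℝ) (p : Fin N × Fin N) : ℝ :=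
  (N : ℝ) ^ 2 * ∫ x in pixel N p, linearised N τ x

/-- The average squared gradient norm `‖c‖² = N⁻² ∑_p ‖c_p‖²`. -/
def meanSqGradient (N : ℕ) (τ : Plane → ℝ) : ℝ :=
  (1 / (N : ℝ) ^ 2) * ∑ p : Fin N × Fin N, ‖pixelGradient N τ p‖ ^ 2

/-! The return pulse received by a pixel. -/

/-- The spatial radius `σ_s = 1 / (√12 N)`. -/
def spatialStd (N : ℕ) : ℝ := 1 / (√12 * (N : ℝ))

/-- The density of the centred planar Gaussian with covariance `σ² I`. -/
def spatialKernel (σ : ℝ) (x : Plane) : ℝ :=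
  1 / (2 * Real.pi * σ ^ 2) * Real.exp (-‖x‖ ^ 2 / (2 * σ ^ 2))

/-- The Gaussian pulse `s(t) = 𝒩(t | 0, σ_t²)`. -/
def pulse (σt t : ℝ) : ℝ := gaussianPDFReal 0 (σt ^ 2).toNNReal t

/-- The effective return pulse `λ_p(t; θ)` of the pixel `p` when the time of arrival at its
mid-point is `θ`: the space-time intensity `α s(t - (θ + c_pᵀ (u - x_p)))`, with
`α = α₀ / N²` the flux of one pixel and without noise floor, is convolved in space with the
Gaussian kernel of standard deviation `σ_s`, and the result is evaluated at `x_p`. -/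
def effectivePulse (N : ℕ) (α₀ σt : ℝ) (τ : Plane → ℝ) (p : Fin N × Fin N) (θ t : ℝ) : ℝ :=
  ∫ u : Plane, spatialKernel (spatialStd N) (center N p - u) *
    (α₀ / (N : ℝ) ^ 2 *
      pulse σt (t - (θ + inner ℝ (pixelGradient N τ p) (u - center N p))))

/-! Time stamps and maximum likelihood. -/

/-- A finite record of time stamps: their number `M` and their values `t_1, …, t_M`. -/
abbrev TimeStamps : Type := Σ M : ℕ, (Fin M → ℝ)

/-- The law of the time stamps of the Poisson process on the real line with the integrable
intensity `r`: with `Q = ∫ r`, the number of time stamps and their values have the joint density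
`e^{-Q} ∏_j r(t_j)` on increasing `M`-tuples. The stamps are listed here in exchangeable order,
hence the density `e^{-Q} / M! ∏_j r(t_j)` on all of `ℝ^M`. -/
def poissonLaw (r : ℝ → ℝ) : Measure TimeStamps :=
  Measure.sum fun M : ℕ =>
    ((volume : Measure (Fin M → ℝ)).withDensity fun t =>
      ENNReal.ofReal (Real.exp (-∫ s, r s) / (M.factorial : ℝ) * ∏ j, r (t j))).map
        (Sigma.mk M)

/-- The log-likelihood `ℒ(θ) = ∑_j log r(t_j; θ)` for a parametric intensity `r θ t`. -/
def logLikelihood (r : ℝ → ℝ → ℝ) (ω : TimeStamps) (θ : ℝ) : ℝ :=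
  ∑ j, Real.log (r θ (ω.2 j))

/-- `θ` is a maximum likelihood estimate for the record `ω`. -/
def IsMLEstimate (r : ℝ → ℝ → ℝ) (ω : TimeStamps) (θ : ℝ) : Prop :=
  IsMaxOn (logLikelihood r ω) Set.univ θ

/-- The first-order expansion of the maximum likelihood estimate at the true value `θ₀`,
`θ₀ - ℒ'(θ₀) / 𝔼[ℒ''(θ₀)]`. -/
def firstOrderML (r : ℝ → ℝ → ℝ) (θ₀ : ℝ) (ω : TimeStamps) : ℝ :=
  θ₀ - deriv (logLikelihood r ω) θ₀ /
    ∫ ω', iteratedDeriv 2 (logLikelihood r ω') θ₀ ∂(poissonLaw (r θ₀))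

/-- The joint law of the time stamps of all pixels: independent Poisson processes with the
effective return pulses, at the true times of arrival `τ(x_p)`, as intensities. -/
def dataLaw (N : ℕ) (α₀ σt : ℝ) (τ : Plane → ℝ) : Measure (Fin N × Fin N → TimeStamps) :=
  Measure.pi fun p => poissonLaw (effectivePulse N α₀ σt τ p (τ (center N p)))

/-- The total variance `𝔼 ∫_{[0,1]²} (τ̂(x) - τ̄(x))² dx` of the piecewise constant
reconstruction `τ̂` whose value on the pixel `p` is the estimate `est p` from the time stamps of
this pixel; `τ̄` is the piecewise constant function of the pixel averages. -/
def totalVariance (N : ℕ) (α₀ σt : ℝ) (τ : Plane → ℝ)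
    (est : Fin N × Fin N → TimeStamps → ℝ) : ℝ :=
  ∫ ω, (∫ x in unitSquare,
    (piecewiseConstant N (fun p => est p (ω p)) x
      - piecewiseConstant N (pixelMean N τ) x) ^ 2) ∂(dataLaw N α₀ σt τ)

end SpadLidar

end

open SpadLidar

namespace SpadLidar

/-! ### The Poisson law of a Gaussian intensity -/

/-! Everything reduces to Gaussian sampling with a Poisson sample size. Smoothing in space replaces
the linear delay `c_pᵀ(u - x_p)` by a centred Gaussian of variance `‖c_p‖² σ_s²`, so the effective
pulse is `a = α₀ / N²` times the Gaussian density with mean `θ` and variance `v_p = ‖c_p‖² σ_s² +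
σ_t²` (`effectivePulse_eq`). A record is then a Poisson number `M` of mean `a` together with `M`
independent Gaussian stamps (`poissonLaw_gaussian`).

The log-likelihood is quadratic in `θ`, with `ℒ' = ∑ (t_j - θ) / v_p` and `ℒ'' = -M / v_p`. Hence
the first-order estimate is `θ + ∑ (t_j - θ) / a`, whose error given `M` is `M v_p / a²`, on average
exactly `v_p / a`. For `M ≥ 1` the unique maximiser is the sample mean, with error `v_p / M` given
`M`. Its mean squared error is thus `v_p 𝔼[1/M; M ≥ 1]` plus `e^{-a}` times the squared error on the
empty record, and `a 𝔼[1/M; M ≥ 1] → 1`.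

In space, pixels overlap only in null sets and the linearised `τ` averages to its midpoint value by
symmetry. The total variance is therefore the average over pixels of the mean squared errors about
`τ(x_p)` (`totalVariance_eq`), and the `v_p` average to `‖c‖² σ_s² + σ_t²`. -/

lemma pi_withDensity_ofReal {ι : Type*} [Fintype ι] {g : ℝ → ℝ} (hg : ∀ x, 0 ≤ g x)
    (hi : Integrable g) :
    (volume : Measure (ι → ℝ)).withDensity (fun t => ENNReal.ofReal (∏ j, g (t j))) =
      Measure.pi fun _ : ι => (volume : Measure ℝ).withDensity fun x => ENNReal.ofReal (g x) := by
  have := isFiniteMeasure_withDensity_ofReal hi.2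
  symm
  refine Measure.pi_eq fun s hs => ?_
  rw [withDensity_apply _ (MeasurableSet.univ_pi hs), volume_pi, Measure.restrict_pi_pi,
    ← ofReal_integral_eq_lintegral_ofReal, integral_fintype_prod_eq_prod,
    ENNReal.ofReal_prod_of_nonneg (fun _ _ => integral_nonneg fun x => hg x)]
  · refine Finset.prod_congr rfl fun i _ => ?_
    rw [withDensity_apply _ (hs i), ofReal_integral_eq_lintegral_ofReal hi.integrableOn
      (ae_of_all _ hg)]
  · exact Integrable.fintype_prod fun i => hi.integrableOn
  · exact ae_of_all _ fun t => Finset.prod_nonneg fun j _ => hg _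

/-- The Poisson weight `e^{-a} a^M / M!`. -/
noncomputable def poissonWeight (a : ℝ) (M : ℕ) : ℝ := Real.exp (-a) * a ^ M / (M.factorial : ℝ)

lemma poissonWeight_nonneg {a : ℝ} (ha : 0 ≤ a) (M : ℕ) : 0 ≤ poissonWeight a M := by
  unfold poissonWeight; positivity

lemma poissonWeight_zero (a : ℝ) : poissonWeight a 0 = Real.exp (-a) := by
  simp [poissonWeight]

/-- This index shift yields all the moments below: each becomes the total mass with its first one or
two terms removed. -/
lemma poissonWeight_succ (a : ℝ) (M : ℕ) :
    poissonWeight a (M + 1) = a * (poissonWeight a M * (1 / ((M : ℝ) + 1))) := by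
  have h1 : (M.factorial : ℝ) ≠ 0 := by positivity
  have h2 : (M : ℝ) + 1 ≠ 0 := by positivity
  unfold poissonWeight
  rw [Nat.factorial_succ, Nat.cast_mul, Nat.cast_succ, pow_succ]
  field_simp

lemma hasSum_poissonWeight (a : ℝ) : HasSum (poissonWeight a) 1 := by
  have h := (NormedSpace.expSeries_div_hasSum_exp (𝔸 := ℝ) a).mul_left (Real.exp (-a))
  rw [← congrFun Real.exp_eq_exp_ℝ a, ← Real.exp_add, neg_add_cancel, Real.exp_zero] at h
  convert! h using 1
  funext M
  rw [poissonWeight, mul_div_assoc]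

/-- A set in the sigma type is measurable iff all its slices are, and the slices of an image are the
original set or empty. -/
lemma measurableEmbedding_sigmaMk {ι : Type*} {β : ι → Type*} [∀ i, MeasurableSpace (β i)]
    [DecidableEq ι] (i : ι) : MeasurableEmbedding (Sigma.mk (β := β) i) where
  injective := sigma_mk_injective
  measurable := by
    intro s hs
    exact (MeasurableSpace.measurableSet_iInf.1 hs i)
  measurableSet_image' := by
    intro s hs
    refine MeasurableSpace.measurableSet_iInf.2 fun j => ?_
    change MeasurableSet (Sigma.mk j ⁻¹' (Sigma.mk i '' s))
    by_cases h : i = j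
    · subst h
      rwa [Set.preimage_image_eq _ sigma_mk_injective]
    · rw [Set.preimage_image_sigmaMk_of_ne (Ne.symm h)]
      exact MeasurableSet.empty

lemma poissonLaw_gaussian {a : ℝ} (ha : 0 ≤ a) (θ : ℝ) {v : NNReal} (hv : v ≠ 0) :
    poissonLaw (fun t => a * gaussianPDFReal θ v t) =
      Measure.sum fun M : ℕ => ENNReal.ofReal (poissonWeight a M) •
        (Measure.pi fun _ : Fin M => gaussianReal θ v).map (Sigma.mk M) := by
  unfold poissonLaw
  congr 1
  funext M
  rw [gaussianReal_of_var_ne_zero _ hv, ← Measure.map_smul]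
  congr 1
  unfold gaussianPDF
  rw [← pi_withDensity_ofReal (gaussianPDFReal_nonneg θ v) (integrable_gaussianPDFReal θ v),
    ← withDensity_smul' _ _ ENNReal.ofReal_ne_top]
  congr 1
  funext t
  rw [Pi.smul_apply, smul_eq_mul, ← ENNReal.ofReal_mul (poissonWeight_nonneg ha M),
    integral_const_mul, integral_gaussianPDFReal_eq_one θ hv, Finset.prod_mul_distrib]
  simp only [Finset.prod_const, Finset.card_univ, Fintype.card_fin, mul_one, poissonWeight]
  congr 1
  ring

/-- Integration is done slice by slice along the embeddings `Sigma.mk M`, so measurability of `f` is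
only needed on each slice. By positivity, convergence of the weighted slice integrals already gives
integrability. -/
lemma integral_poissonLaw_gaussian {a : ℝ} (ha : 0 ≤ a) (θ : ℝ) {v : NNReal} (hv : v ≠ 0)
    {f : TimeStamps → ℝ} (hf : ∀ ω, 0 ≤ f ω) {m : ℕ → ℝ} {S : ℝ}
    (hi : ∀ M, Integrable (fun t => f ⟨M, t⟩) (Measure.pi fun _ : Fin M => gaussianReal θ v))
    (hm : ∀ M, ∫ t, f ⟨M, t⟩ ∂(Measure.pi fun _ : Fin M => gaussianReal θ v) = m M)
    (hS : HasSum (fun M => poissonWeight a M * m M) S) :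
    Integrable f (poissonLaw fun t => a * gaussianPDFReal θ v t) ∧
      ∫ ω, f ω ∂(poissonLaw fun t => a * gaussianPDFReal θ v t) = S := by
  rw [poissonLaw_gaussian ha θ hv]
  have hint : ∀ M, ∫ ω, f ω ∂(ENNReal.ofReal (poissonWeight a M) •
        (Measure.pi fun _ : Fin M => gaussianReal θ v).map (Sigma.mk M)) =
        poissonWeight a M * m M := fun M => by
    rw [integral_smul_measure, (measurableEmbedding_sigmaMk M).integral_map, hm,
      ENNReal.toReal_ofReal (poissonWeight_nonneg ha M), smul_eq_mul]
  have hI : Integrable f (Measure.sum fun M : ℕ => ENNReal.ofReal (poissonWeight a M) •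
        (Measure.pi fun _ : Fin M => gaussianReal θ v).map (Sigma.mk M)) := by
    refine integrable_sum_measure (fun M => Integrable.smul_measure ?_ ENNReal.ofReal_ne_top) ?_
    · exact (measurableEmbedding_sigmaMk M).integrable_map_iff.2 (hi M)
    · simp only [Real.norm_of_nonneg (hf _), hint]
      exact hS.summable
  refine ⟨hI, ?_⟩
  rw [integral_sum_measure hI]
  simp only [hint]
  exact hS.tsum_eq

lemma isProbabilityMeasure_poissonLaw_gaussian {a : ℝ} (ha : 0 ≤ a) (θ : ℝ) {v : NNReal}
    (hv : v ≠ 0) : IsProbabilityMeasure (poissonLaw fun t => a * gaussianPDFReal θ v t) := by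
  obtain ⟨h1, h2⟩ := integral_poissonLaw_gaussian ha θ hv (f := fun _ => 1) (m := fun _ => 1)
    (S := 1) (fun _ => zero_le_one) (fun M => integrable_const _) (fun M => by simp)
    (by simpa using hasSum_poissonWeight a)
  have : IsFiniteMeasure (poissonLaw fun t => a * gaussianPDFReal θ v t) :=
    (integrable_const_iff_isFiniteMeasure one_ne_zero).1 h1
  constructor
  rw [integral_const, smul_eq_mul, mul_one, measureReal_def] at h2
  rwa [ENNReal.toReal_eq_one_iff] at h2

/-! ### Moments -/

lemma hasSum_poissonWeight_mul_nat (a : ℝ) :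
    HasSum (fun M : ℕ => poissonWeight a M * M) a := by
  rw [← hasSum_nat_add_iff' 1]
  have h := (hasSum_poissonWeight a).mul_left a
  simp only [Finset.range_one, Finset.sum_singleton, Nat.cast_zero, mul_zero, sub_zero]
  rw [mul_one] at h
  convert! h using 1
  funext M
  have h2 : (M : ℝ) + 1 ≠ 0 := by positivity
  rw [poissonWeight_succ, Nat.cast_succ]
  field_simp

lemma hasSum_poissonWeight_div_succ {a : ℝ} (ha : a ≠ 0) :
    HasSum (fun M : ℕ => poissonWeight a M * (1 / ((M : ℝ) + 1))) ((1 - Real.exp (-a)) / a) := by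
  have h := ((hasSum_nat_add_iff' 1).2 (hasSum_poissonWeight a)).div_const a
  rw [Finset.range_one, Finset.sum_singleton, poissonWeight_zero] at h
  convert! h using 1
  funext M
  rw [poissonWeight_succ, mul_div_cancel_left₀ _ ha]

lemma hasSum_poissonWeight_div_succ_succ {a : ℝ} (ha : a ≠ 0) :
    HasSum (fun M : ℕ => poissonWeight a M * (1 / (((M : ℝ) + 1) * (M + 2))))
      ((1 - Real.exp (-a) * (1 + a)) / a ^ 2) := by
  have h := ((hasSum_nat_add_iff' 2).2 (hasSum_poissonWeight a)).div_const (a ^ 2)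
  rw [Finset.sum_range_succ, Finset.sum_range_one, poissonWeight_succ, poissonWeight_zero] at h
  convert! h using 2 with M
  · have h2 : (M : ℝ) + 1 ≠ 0 := by positivity
    have h3 : (M : ℝ) + 2 ≠ 0 := by positivity
    rw [show M + 2 = (M + 1) + 1 from rfl, poissonWeight_succ, poissonWeight_succ, Nat.cast_succ,
      add_assoc, one_add_one_eq_two]
    field_simp
  · push_cast
    ring

/-- The centred sum has mean zero, so its second moment is its variance, which is additive over
independent stamps. -/
lemma integrable_integral_sq_centredSum (θ : ℝ) (v : NNReal) (M : ℕ) :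
    Integrable (fun t : Fin M → ℝ => (∑ j, (t j - θ)) ^ 2)
        (Measure.pi fun _ : Fin M => gaussianReal θ v) ∧
      ∫ t, (∑ j, (t j - θ)) ^ 2 ∂(Measure.pi fun _ : Fin M => gaussianReal θ v) = M * v := by
  have hL : MemLp (fun x : ℝ => x - θ) 2 (gaussianReal θ v) :=
    (memLp_id_gaussianReal 2).sub (memLp_const θ)
  have hL' : ∀ j : Fin M, MemLp (fun t : Fin M → ℝ => t j - θ) 2
      (Measure.pi fun _ : Fin M => gaussianReal θ v) := fun j =>
    hL.comp_measurePreserving (measurePreserving_eval _ j)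
  have hsum := memLp_finsetSum Finset.univ (fun j _ => hL' j)
  refine ⟨hsum.integrable_sq, ?_⟩
  have hV := variance_sum_pi (μ := fun _ : Fin M => gaussianReal θ v)
    (X := fun _ x => x - θ) (fun _ => hL)
  have h0 : ∫ t, (∑ j, fun t : Fin M → ℝ => t j - θ) t
      ∂(Measure.pi fun _ : Fin M => gaussianReal θ v) = 0 := by
    simp only [Finset.sum_apply]
    rw [integral_finsetSum _ fun j _ => (hL' j).integrable one_le_two]
    refine Finset.sum_eq_zero fun j _ => ?_
    rw [integral_comp_eval (μ := fun _ : Fin M => gaussianReal θ v) (f := fun x : ℝ => x - θ)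
      hL.aestronglyMeasurable, integral_sub (memLp_one_iff_integrable.1 (memLp_id_gaussianReal 1) :
        Integrable (fun x : ℝ => x) _) (integrable_const _)]
    simp
  rw [variance_of_integral_eq_zero (by fun_prop) h0] at hV
  simp only [Finset.sum_apply] at hV
  rw [hV]
  simp [variance_sub_const (aemeasurable_id' (μ := gaussianReal θ v)).aestronglyMeasurable]

/-! ### The pixel grid -/

/-- The closed box with the corners `l` and `u`. -/
def box (l u : Fin 2 → ℝ) : Set Plane := {x | ∀ i, x i ∈ Set.Icc (l i) (u i)}

lemma isClosed_box (l u : Fin 2 → ℝ) : IsClosed (box l u) := by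
  simp only [box, Set.ofPred_forall]
  exact isClosed_iInter fun i => isClosed_Icc.preimage (by fun_prop)

lemma volume_box (l u : Fin 2 → ℝ) : volume (box l u) = ∏ i, ENNReal.ofReal (u i - l i) := by
  have h : WithLp.toLp 2 ⁻¹' box l u = Set.Icc l u := by
    ext x
    simp [box, Pi.le_def, forall_and]
  rw [← (PiLp.volume_preserving_toLp (Fin 2)).measure_preimage
    (isClosed_box l u).measurableSet.nullMeasurableSet, h, Real.volume_Icc_pi]

lemma box_inter_box (l u l' u' : Fin 2 → ℝ) :
    box l u ∩ box l' u' = box (fun i => max (l i) (l' i)) (fun i => min (u i) (u' i)) := by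
  ext x
  simp only [box, Set.mem_inter_iff, Set.mem_ofPred_eq, ← forall_and, Set.mem_Icc, max_le_iff,
    le_min_iff]
  exact forall_congr' fun i => by tauto

lemma volume_box_inter_box_eq_zero {l u l' u' : Fin 2 → ℝ} (i : Fin 2)
    (h : u i ≤ l' i ∨ u' i ≤ l i) : volume (box l u ∩ box l' u') = 0 := by
  rw [box_inter_box, volume_box]
  refine Finset.prod_eq_zero (Finset.mem_univ i) (ENNReal.ofReal_of_nonpos (sub_nonpos.2 ?_))
  rcases h with h | h
  · exact (min_le_left _ _).trans (h.trans (le_max_right _ _))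
  · exact (min_le_right _ _).trans (h.trans (le_max_left _ _))

variable {N : ℕ}

/-- The lower left corner of a pixel. -/
noncomputable def lowerCorner (p : Fin N × Fin N) : Fin 2 → ℝ :=
  ![((p.1 : ℕ) : ℝ) / N, ((p.2 : ℕ) : ℝ) / N]

/-- The upper right corner of a pixel. -/
noncomputable def upperCorner (p : Fin N × Fin N) : Fin 2 → ℝ :=
  ![(((p.1 : ℕ) : ℝ) + 1) / N, (((p.2 : ℕ) : ℝ) + 1) / N]

lemma pixel_eq_box (p : Fin N × Fin N) : pixel N p = box (lowerCorner p) (upperCorner p) := by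
  ext x
  simp [pixel, box, lowerCorner, upperCorner, Fin.forall_fin_two]

lemma measurableSet_pixel (p : Fin N × Fin N) : MeasurableSet (pixel N p) := by
  rw [pixel_eq_box]
  exact (isClosed_box _ _).measurableSet

lemma volume_pixel (p : Fin N × Fin N) : volume (pixel N p) = ENNReal.ofReal (1 / (N : ℝ) ^ 2) := by
  rw [pixel_eq_box, volume_box, Fin.prod_univ_two, ← ENNReal.ofReal_mul' (by
    simp only [lowerCorner, upperCorner, Matrix.cons_val_one, Matrix.cons_val_zero, ← sub_div]
    rw [add_sub_cancel_left]
    positivity)]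
  simp only [lowerCorner, upperCorner, Matrix.cons_val_one, Matrix.cons_val_zero, ← sub_div]
  congr 1
  ring

lemma volume_pixel_ne_top (p : Fin N × Fin N) : volume (pixel N p) ≠ ⊤ := by
  rw [volume_pixel]
  exact ENNReal.ofReal_ne_top

lemma volume_real_pixel (p : Fin N × Fin N) : volume.real (pixel N p) = 1 / (N : ℝ) ^ 2 := by
  rw [measureReal_def, volume_pixel, ENNReal.toReal_ofReal (by positivity)]

lemma grid_le_or_le {a b : Fin N} (h : a ≠ b) :
    (((a : ℕ) : ℝ) + 1) / N ≤ ((b : ℕ) : ℝ) / N ∨ (((b : ℕ) : ℝ) + 1) / N ≤ ((a : ℕ) : ℝ) / N := by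
  rcases lt_or_gt_of_ne h with h | h
  · left
    gcongr
    exact_mod_cast h
  · right
    gcongr
    exact_mod_cast h

/-- Closed pixels share edges, where several windows equal `1`; this makes the overlaps invisible to
integrals. -/
lemma volume_pixel_inter_pixel {p q : Fin N × Fin N} (h : p ≠ q) :
    volume (pixel N p ∩ pixel N q) = 0 := by
  rw [pixel_eq_box, pixel_eq_box]
  by_cases h1 : p.1 = q.1
  · exact volume_box_inter_box_eq_zero 1 (grid_le_or_le fun h2 => h (Prod.ext h1 h2))
  · exact volume_box_inter_box_eq_zero 0 (grid_le_or_le h1)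

lemma pixel_subset_unitSquare (hN : 0 < N) (p : Fin N × Fin N) : pixel N p ⊆ unitSquare := by
  have hN' : (0 : ℝ) < N := by exact_mod_cast hN
  have key : ∀ a : Fin N, ∀ y : ℝ, y ∈ Set.Icc (((a : ℕ) : ℝ) / N) ((((a : ℕ) : ℝ) + 1) / N) →
      y ∈ Set.Icc (0 : ℝ) 1 := fun a y hy => by
    refine ⟨le_trans (by positivity) hy.1, hy.2.trans ?_⟩
    rw [div_le_one hN']
    exact_mod_cast a.2
  intro x hx
  exact Fin.forall_fin_two.2 ⟨key _ _ hx.1, key _ _ hx.2⟩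

lemma pixelWindow_eq_indicator (hN : 0 < N) (p : Fin N × Fin N) (x : Plane) :
    pixelWindow N p x = (pixel N p).indicator (fun _ => 1) x := by
  have hN' : (0 : ℝ) < N := by exact_mod_cast hN
  have key : ∀ a : Fin N, ∀ y : ℝ, (N : ℝ) * y - ((a : ℕ) : ℝ) ∈ Set.Icc (0 : ℝ) 1 ↔
      y ∈ Set.Icc (((a : ℕ) : ℝ) / N) ((((a : ℕ) : ℝ) + 1) / N) := fun a y => by
    rw [Set.mem_Icc, Set.mem_Icc, div_le_iff₀ hN', le_div_iff₀ hN', sub_nonneg,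
      sub_le_iff_le_add, mul_comm, add_comm (1 : ℝ)]
  classical
  simp only [pixelWindow, boxcar, Set.indicator_apply, key, pixel, Set.mem_ofPred_eq]
  split_ifs <;> simp_all

lemma pixelWindow_mul_eq_indicator (hN : 0 < N) (p q : Fin N × Fin N) (x : Plane) :
    pixelWindow N p x * pixelWindow N q x =
      (pixel N p ∩ pixel N q).indicator (fun _ => (1 : ℝ)) x := by
  rw [pixelWindow_eq_indicator hN, pixelWindow_eq_indicator hN]
  simpa using (Set.inter_indicator_mul (s := pixel N p) (t := pixel N q) (fun _ => (1 : ℝ))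
    (fun _ => 1) x).symm

lemma integral_pixelWindow_mul (hN : 0 < N) (p q : Fin N × Fin N) :
    ∫ x in unitSquare, pixelWindow N p x * pixelWindow N q x =
      if p = q then 1 / (N : ℝ) ^ 2 else 0 := by
  have hm := (measurableSet_pixel p).inter (measurableSet_pixel q)
  simp only [pixelWindow_mul_eq_indicator hN]
  rw [integral_indicator_const _ hm, smul_eq_mul, mul_one, measureReal_restrict_apply hm,
    Set.inter_eq_left.2 (Set.inter_subset_left.trans (pixel_subset_unitSquare hN p))]
  split_ifs with hpq
  · rw [hpq, Set.inter_self, volume_real_pixel]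
  · rw [measureReal_def, volume_pixel_inter_pixel hpq, ENNReal.toReal_zero]

lemma integrable_pixelWindow_mul (hN : 0 < N) (p q : Fin N × Fin N) :
    Integrable (fun x => pixelWindow N p x * pixelWindow N q x) := by
  simp only [pixelWindow_mul_eq_indicator hN]
  exact (integrable_indicator_iff ((measurableSet_pixel p).inter (measurableSet_pixel q))).2
    (integrableOn_const (measure_ne_top_of_subset Set.inter_subset_left (volume_pixel_ne_top p)))

/-- The squared `L²` distance of two piecewise constant functions. -/
lemma integral_sq_piecewiseConstant_sub (hN : 0 < N) (v w : Fin N × Fin N → ℝ) :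
    ∫ x in unitSquare, (piecewiseConstant N v x - piecewiseConstant N w x) ^ 2 =
      1 / (N : ℝ) ^ 2 * ∑ p, (v p - w p) ^ 2 := by
  have h : ∀ x, (piecewiseConstant N v x - piecewiseConstant N w x) ^ 2 =
      ∑ p, ∑ q, ((v p - w p) * (v q - w q)) * (pixelWindow N p x * pixelWindow N q x) := fun x => by
    rw [piecewiseConstant, piecewiseConstant, ← Finset.sum_sub_distrib, sq, Finset.sum_mul_sum]
    exact Finset.sum_congr rfl fun p _ => Finset.sum_congr rfl fun q _ => by ring
  have hi := fun p q : Fin N × Fin N => (integrable_pixelWindow_mul hN p q).integrableOn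
    (s := unitSquare)
  simp only [h]
  rw [integral_finsetSum _ fun p _ => integrable_finsetSum _ fun q _ => (hi p q).const_mul _,
    Finset.mul_sum]
  refine Finset.sum_congr rfl fun p _ => ?_
  rw [integral_finsetSum _ fun q _ => (hi p q).const_mul _]
  simp only [integral_const_mul, integral_pixelWindow_mul hN, mul_ite, mul_zero,
    Finset.sum_ite_eq, Finset.mem_univ, if_true]
  ring

lemma reflect_mem_pixel_iff (hN : 0 < N) (p : Fin N × Fin N) (x : Plane) :
    center N p + center N p - x ∈ pixel N p ↔ x ∈ pixel N p := by
  have hN' : (0 : ℝ) < N := by exact_mod_cast hN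
  have key : ∀ a y : ℝ, (2 * a + 1) / (2 * N) + (2 * a + 1) / (2 * N) - y ∈
      Set.Icc (a / N) ((a + 1) / N) ↔ y ∈ Set.Icc (a / N) ((a + 1) / N) := fun a y => by
    have : (2 * a + 1) / (2 * N) + (2 * a + 1) / (2 * N) = a / N + (a + 1) / N := by
      field_simp
      ring
    rw [this, Set.mem_Icc, Set.mem_Icc]
    constructor <;> rintro ⟨h1, h2⟩ <;> constructor <;> linarith
  simpa [pixel, center] using and_congr (key (p.1 : ℕ) (x 0)) (key (p.2 : ℕ) (x 1))

/-- The reflection `x ↦ 2 x_p - x` preserves the pixel and Lebesgue measure and changes the sign of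
the integrand. -/
lemma integral_inner_sub_center (hN : 0 < N) (p : Fin N × Fin N) (c : Plane) :
    ∫ x in pixel N p, inner ℝ c (x - center N p) = 0 := by
  classical
  rw [← integral_indicator (measurableSet_pixel p)]
  have h := integral_sub_left_eq_self
    ((pixel N p).indicator fun x => inner ℝ c (x - center N p)) (volume : Measure Plane)
    (center N p + center N p)
  have h' : ∀ x, (pixel N p).indicator (fun x => inner ℝ c (x - center N p))
      (center N p + center N p - x) =
      -(pixel N p).indicator (fun x => inner ℝ c (x - center N p)) x := fun x => by
    simp only [Set.indicator_apply, reflect_mem_pixel_iff hN]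
    split_ifs
    · rw [← inner_neg_right]
      congr 1
      abel
    · simp
  simp only [h', integral_neg] at h
  linarith

lemma integrableOn_pixel_of_continuous (p : Fin N × Fin N) {f : Plane → ℝ} (hf : Continuous f) :
    IntegrableOn f (pixel N p) := by
  refine hf.continuousOn.integrableOn_compact ?_
  have h : pixel N p = WithLp.toLp 2 '' Set.Icc (lowerCorner p) (upperCorner p) := by
    rw [pixel_eq_box]
    ext x
    constructor
    · exact fun hx => ⟨WithLp.ofLp x, ⟨fun i => (hx i).1, fun i => (hx i).2⟩, rfl⟩
    · rintro ⟨y, hy, rfl⟩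
      exact fun i => ⟨hy.1 i, hy.2 i⟩
  rw [h]
  exact isCompact_Icc.image (PiLp.continuous_toLp 2 _)

lemma pixelMean_eq (hN : 0 < N) (τ : Plane → ℝ) (p : Fin N × Fin N) :
    pixelMean N τ p = τ (center N p) := by
  have hN' : (N : ℝ) ≠ 0 := by exact_mod_cast hN.ne'
  set f : Fin N × Fin N → Plane → ℝ := fun q x =>
    τ (center N q) + inner ℝ (pixelGradient N τ q) (x - center N q) with hf
  have hc : ∀ q, Continuous (f q) := fun q => by fun_prop
  have hlin : ∀ x, linearised N τ x = ∑ q, (pixel N q).indicator (f q) x := fun x => by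
    unfold linearised
    refine Finset.sum_congr rfl fun q _ => ?_
    classical
    rw [pixelWindow_eq_indicator hN]
    simp [Set.indicator_apply, hf]
  have hp : ∫ x in pixel N p, linearised N τ x = ∫ x in pixel N p, f p x := by
    simp only [hlin]
    rw [integral_finsetSum _ fun q _ => ((integrable_indicator_iff (measurableSet_pixel q)).2
      (integrableOn_pixel_of_continuous q (hc q))).integrableOn,
      Finset.sum_eq_single_of_mem p (Finset.mem_univ p)]
    · exact setIntegral_congr_fun (measurableSet_pixel p) fun x hx => Set.indicator_of_mem hx _
    · intro q _ hq
      rw [setIntegral_indicator (measurableSet_pixel q)]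
      exact setIntegral_measure_zero _ (volume_pixel_inter_pixel hq.symm)
  have hsum : ∫ x in pixel N p, f p x = (∫ _ in pixel N p, τ (center N p)) +
      ∫ x in pixel N p, inner ℝ (pixelGradient N τ p) (x - center N p) :=
    integral_add (integrableOn_pixel_of_continuous p continuous_const).integrable
      (integrableOn_pixel_of_continuous p (by fun_prop)).integrable
  rw [pixelMean, hp, hsum, integral_inner_sub_center hN, setIntegral_const, volume_real_pixel,
    smul_eq_mul]
  field_simp
  ring

/-! ### The effective pulse is Gaussian -/

/-- Completing the square in `x`: the joint density factors into the marginal of `s`, of variance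
`D`, and the conditional density of `x` given `s`. -/
lemma gaussianPDFReal_mul_affine {a b D : NNReal} (ha : a ≠ 0) (hb : b ≠ 0) (c : ℝ)
    (hD : (D : ℝ) = c ^ 2 * a + b) (s x : ℝ) :
    gaussianPDFReal 0 a x * gaussianPDFReal 0 b (s + c * x) =
      gaussianPDFReal 0 D s * gaussianPDFReal (-(c * a * s) / D) (a * b / D) x := by
  have ha' : (0 : ℝ) < a := by positivity
  have hb' : (0 : ℝ) < b := by positivity
  have hD' : (0 : ℝ) < D := by rw [hD]; positivity
  have e1 : ∀ A B p q : ℝ, (A * Real.exp p) * (B * Real.exp q) = (A * B) * Real.exp (p + q) :=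
    fun A B p q => by rw [Real.exp_add]; ring
  simp only [gaussianPDFReal, NNReal.coe_div, NNReal.coe_mul]
  rw [e1, e1, ← mul_inv, ← mul_inv, ← Real.sqrt_mul (by positivity),
    ← Real.sqrt_mul (by positivity)]
  congr 1
  · congr 2
    field_simp
  · congr 1
    field_simp
    rw [hD]
    ring

lemma integral_gaussianPDFReal_mul_affine {a b D : NNReal} (ha : a ≠ 0) (hb : b ≠ 0) (c : ℝ)
    (hD : (D : ℝ) = c ^ 2 * a + b) (s : ℝ) :
    ∫ x, gaussianPDFReal 0 a x * gaussianPDFReal 0 b (s + c * x) = gaussianPDFReal 0 D s := by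
  have hb' : (0 : ℝ) < b := by positivity
  have hD' : D ≠ 0 := by
    rw [← NNReal.coe_ne_zero, hD]
    positivity
  simp only [gaussianPDFReal_mul_affine ha hb c hD s]
  rw [integral_const_mul, integral_gaussianPDFReal_eq_one _ (by positivity), mul_one]

lemma spatialKernel_eq {a : NNReal} (σ : ℝ) (h : (a : ℝ) = σ ^ 2) (x : Plane) :
    spatialKernel σ x = gaussianPDFReal 0 a (x 0) * gaussianPDFReal 0 a (x 1) := by
  have e1 : ∀ A p q : ℝ, (A * Real.exp p) * (A * Real.exp q) = (A * A) * Real.exp (p + q) :=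
    fun A p q => by rw [Real.exp_add]; ring
  simp only [gaussianPDFReal, spatialKernel]
  rw [e1, ← mul_inv, Real.mul_self_sqrt (by positivity), h, EuclideanSpace.norm_sq_eq,
    Fin.sum_univ_two, one_div, Real.norm_eq_abs, Real.norm_eq_abs, sq_abs, sq_abs]
  congr 2
  ring

lemma gaussianPDFReal_le (v : NNReal) (x : ℝ) : gaussianPDFReal 0 v x ≤ (√(2 * Real.pi * v))⁻¹ := by
  refine mul_le_of_le_one_right (by positivity) (Real.exp_le_one_iff.2 ?_)
  rw [neg_div]
  exact neg_nonpos.2 (by positivity)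

lemma integral_spatialKernel_mul_gaussianPDFReal {a b D : NNReal} (ha : a ≠ 0) (hb : b ≠ 0)
    (σ : ℝ) (hσ : (a : ℝ) = σ ^ 2) (c : Plane) (hD : (D : ℝ) = ‖c‖ ^ 2 * a + b) (s : ℝ) :
    ∫ x : Plane, spatialKernel σ x * gaussianPDFReal 0 b (s + inner ℝ c x) =
      gaussianPDFReal 0 D s := by
  -- `E` is the variance after integrating out the first coordinate only; the second coordinate then
  -- raises it to `D`.
  obtain ⟨E, hE⟩ : ∃ E : NNReal, (E : ℝ) = c 0 ^ 2 * a + b := ⟨⟨c 0 ^ 2 * a + b, by positivity⟩, rfl⟩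
  have hb' : (0 : ℝ) < b := by positivity
  have hE' : E ≠ 0 := by
    rw [← NNReal.coe_ne_zero, hE]
    positivity
  rw [EuclideanSpace.norm_sq_eq, Fin.sum_univ_two, Real.norm_eq_abs, Real.norm_eq_abs, sq_abs,
    sq_abs] at hD
  rw [← (PiLp.volume_preserving_toLp (Fin 2)).integral_comp
    (MeasurableEquiv.toLp 2 (Fin 2 → ℝ)).measurableEmbedding,
    ← (volume_preserving_finTwoArrow ℝ).symm.integral_comp
    (MeasurableEquiv.measurableEmbedding _)]
  have hpt : ∀ z : ℝ × ℝ,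
      spatialKernel σ (WithLp.toLp 2 (MeasurableEquiv.finTwoArrow.symm z)) * gaussianPDFReal 0 b
        (s + inner ℝ c (WithLp.toLp 2 (MeasurableEquiv.finTwoArrow.symm z))) =
      (gaussianPDFReal 0 a z.1 * gaussianPDFReal 0 a z.2) *
        gaussianPDFReal 0 b ((s + c 1 * z.2) + c 0 * z.1) := fun z => by
    rw [spatialKernel_eq σ hσ, PiLp.inner_apply, Fin.sum_univ_two]
    simp [MeasurableEquiv.finTwoArrow]
    left
    congr 1
    ring
  simp only [hpt]
  have hint : Integrable (fun z : ℝ × ℝ => (gaussianPDFReal 0 a z.1 * gaussianPDFReal 0 a z.2) *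
        gaussianPDFReal 0 b ((s + c 1 * z.2) + c 0 * z.1)) (volume.prod volume) := by
    refine ((integrable_gaussianPDFReal 0 a).mul_prod (integrable_gaussianPDFReal 0 a)).mul_bdd
      (c := (√(2 * Real.pi * b))⁻¹) ?_ (ae_of_all _ fun z => ?_)
    · exact ((measurable_gaussianPDFReal 0 b).comp (by fun_prop)).aestronglyMeasurable
    · rw [Real.norm_of_nonneg (gaussianPDFReal_nonneg _ _ _)]
      exact gaussianPDFReal_le b _
  rw [Measure.volume_eq_prod, integral_prod_symm _ hint]
  have hin : ∀ y, ∫ x, (gaussianPDFReal 0 a x * gaussianPDFReal 0 a y) *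
        gaussianPDFReal 0 b ((s + c 1 * y) + c 0 * x) =
        gaussianPDFReal 0 a y * gaussianPDFReal 0 E (s + c 1 * y) := fun y => by
    rw [← integral_gaussianPDFReal_mul_affine ha hb (c 0) hE, ← integral_const_mul]
    exact integral_congr_ae (ae_of_all _ fun x => by ring)
  simp only [hin]
  exact integral_gaussianPDFReal_mul_affine ha hE' (c 1) (by rw [hD, hE]; ring) s

/-- The variance `‖c_p‖² σ_s² + σ_t²` of the effective pulse of a pixel. -/
noncomputable def pulseVariance (N : ℕ) (σt : ℝ) (τ : Plane → ℝ) (p : Fin N × Fin N) : NNReal :=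
  (‖pixelGradient N τ p‖ ^ 2 * spatialStd N ^ 2 + σt ^ 2).toNNReal

lemma coe_pulseVariance (N : ℕ) (σt : ℝ) (τ : Plane → ℝ) (p : Fin N × Fin N) :
    (pulseVariance N σt τ p : ℝ) = ‖pixelGradient N τ p‖ ^ 2 * spatialStd N ^ 2 + σt ^ 2 :=
  Real.coe_toNNReal _ (by positivity)

lemma pulseVariance_ne_zero (N : ℕ) {σt : ℝ} (hσt : 0 < σt) (τ : Plane → ℝ) (p : Fin N × Fin N) :
    pulseVariance N σt τ p ≠ 0 := by
  rw [← NNReal.coe_ne_zero, coe_pulseVariance]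
  positivity

lemma effectivePulse_eq {N : ℕ} (hN : 0 < N) (α₀ : ℝ) {σt : ℝ} (hσt : 0 < σt) (τ : Plane → ℝ)
    (p : Fin N × Fin N) (θ t : ℝ) :
    effectivePulse N α₀ σt τ p θ t =
      α₀ / (N : ℝ) ^ 2 * gaussianPDFReal θ (pulseVariance N σt τ p) t := by
  have hN' : (0 : ℝ) < N := by exact_mod_cast hN
  have hs : 0 < spatialStd N := by unfold spatialStd; positivity
  -- The substitution `x = x_p - u` turns the convolution at the midpoint into a Gaussian integral
  -- centred at the origin.
  have h := integral_sub_left_eq_self (fun x => α₀ / (N : ℝ) ^ 2 * (spatialKernel (spatialStd N) x *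
    gaussianPDFReal 0 (σt ^ 2).toNNReal (t - θ + inner ℝ (pixelGradient N τ p) x)))
    (volume : Measure Plane) (center N p)
  rw [integral_const_mul, integral_const_mul, integral_spatialKernel_mul_gaussianPDFReal
    (a := (spatialStd N ^ 2).toNNReal) (D := pulseVariance N σt τ p)
    (Real.toNNReal_pos.2 (by positivity)).ne' (Real.toNNReal_pos.2 (by positivity)).ne' _
    (Real.coe_toNNReal _ (by positivity)) _
    (by rw [coe_pulseVariance, Real.coe_toNNReal _ (by positivity),
          Real.coe_toNNReal _ (by positivity)]), gaussianPDFReal_sub, zero_add] at h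
  rw [← h, effectivePulse, ← integral_const_mul]
  refine integral_congr_ae (ae_of_all _ fun (u : Plane) => ?_)
  have : t - (θ + inner ℝ (pixelGradient N τ p) (u - center N p)) =
      t - θ + inner ℝ (pixelGradient N τ p) (center N p - u) := by
    rw [← neg_sub u (center N p), inner_neg_right]
    ring
  simp only [pulse, this]
  ring

/-! ### The Gaussian likelihood -/

lemma logLikelihood_gaussian {a : ℝ} (ha : 0 < a) {v : NNReal} (hv : v ≠ 0) (ω : TimeStamps) :
    logLikelihood (fun θ t => a * gaussianPDFReal θ v t) ω =
      fun θ => ∑ j, (Real.log (a * (√(2 * Real.pi * v))⁻¹) - (ω.2 j - θ) ^ 2 / (2 * v)) := by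
  have hv' : (0 : ℝ) < v := by positivity
  funext θ
  refine Finset.sum_congr rfl fun j _ => ?_
  simp only [gaussianPDFReal]
  rw [← mul_assoc, Real.log_mul (by positivity) (Real.exp_ne_zero _),
    Real.log_exp, neg_div, ← sub_eq_add_neg]

lemma hasDerivAt_logLikelihood_gaussian {a : ℝ} (ha : 0 < a) {v : NNReal} (hv : v ≠ 0)
    (ω : TimeStamps) (θ : ℝ) :
    HasDerivAt (logLikelihood (fun θ t => a * gaussianPDFReal θ v t) ω)
      (∑ j, (ω.2 j - θ) / v) θ := by
  have hv' : (v : ℝ) ≠ 0 := by positivity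
  rw [logLikelihood_gaussian ha hv]
  refine HasDerivAt.fun_sum fun j _ => ?_
  have h := ((((hasDerivAt_id θ).const_sub (ω.2 j)).pow 2).div_const (2 * (v : ℝ))).const_sub
    (Real.log (a * (√(2 * Real.pi * v))⁻¹))
  convert! h using 1
  simp only [id]
  field_simp
  norm_num
  ring

lemma iteratedDeriv_two_logLikelihood_gaussian {a : ℝ} (ha : 0 < a) {v : NNReal} (hv : v ≠ 0)
    (ω : TimeStamps) (θ : ℝ) :
    iteratedDeriv 2 (logLikelihood (fun θ t => a * gaussianPDFReal θ v t) ω) θ = -(ω.1 / v) := by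
  rw [iteratedDeriv_succ, iteratedDeriv_one,
    funext fun θ => (hasDerivAt_logLikelihood_gaussian ha hv ω θ).deriv]
  have h : HasDerivAt (fun θ : ℝ => ∑ j, (ω.2 j - θ) / (v : ℝ)) (∑ _j : Fin ω.1, -1 / (v : ℝ)) θ :=
    HasDerivAt.fun_sum fun j _ => ((hasDerivAt_id θ).const_sub (ω.2 j)).div_const _
  rw [h.deriv, Finset.sum_const, Finset.card_univ, Fintype.card_fin, nsmul_eq_mul]
  ring

lemma firstOrderML_gaussian {a : ℝ} (ha : 0 < a) {v : NNReal} (hv : v ≠ 0) (θ : ℝ)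
    (ω : TimeStamps) :
    firstOrderML (fun θ t => a * gaussianPDFReal θ v t) θ ω = θ + (∑ j, (ω.2 j - θ)) / a := by
  have hv' : (v : ℝ) ≠ 0 := by positivity
  have hI : ∫ ω : TimeStamps, (ω.1 : ℝ) ∂(poissonLaw fun t => a * gaussianPDFReal θ v t) = a :=
    (integral_poissonLaw_gaussian ha.le θ hv (f := fun ω => (ω.1 : ℝ)) (m := fun M => (M : ℝ))
      (fun ω => by positivity) (fun M => integrable_const (M : ℝ)) (fun M => by simp)
      (hasSum_poissonWeight_mul_nat a)).2
  unfold firstOrderML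
  simp only [iteratedDeriv_two_logLikelihood_gaussian ha hv]
  rw [integral_neg, integral_div, hI, (hasDerivAt_logLikelihood_gaussian ha hv ω θ).deriv,
    ← Finset.sum_div]
  field_simp
  ring

lemma isMLEstimate_gaussian_iff {a : ℝ} (ha : 0 < a) {v : NNReal} (hv : v ≠ 0)
    {ω : TimeStamps} (hω : 0 < ω.1) (θ : ℝ) :
    IsMLEstimate (fun θ t => a * gaussianPDFReal θ v t) ω θ ↔ θ = (∑ j, ω.2 j) / ω.1 := by
  have hv' : (0 : ℝ) < v := by positivity
  have hM : (0 : ℝ) < ω.1 := by exact_mod_cast hω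
  set m := (∑ j, ω.2 j) / ω.1 with hm
  have hS : ∑ j, ω.2 j = ω.1 * m := by rw [hm]; field_simp
  -- Since `ℒ` is quadratic, its expansion about the sample mean `m` is exact and has no linear
  -- term.
  have key : ∀ x, logLikelihood (fun θ t => a * gaussianPDFReal θ v t) ω x =
      logLikelihood (fun θ t => a * gaussianPDFReal θ v t) ω m - ω.1 / (2 * v) * (x - m) ^ 2 :=
    fun x => by
      rw [logLikelihood_gaussian ha hv]
      have h : ∀ j, Real.log (a * (√(2 * Real.pi * v))⁻¹) - (ω.2 j - x) ^ 2 / (2 * v) =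
          (Real.log (a * (√(2 * Real.pi * v))⁻¹) - (ω.2 j - m) ^ 2 / (2 * v)) +
            ((x - m) / v * ω.2 j + (m ^ 2 - x ^ 2) / (2 * v)) := fun j => by
        field_simp
        ring
      simp only [h]
      rw [Finset.sum_add_distrib, Finset.sum_add_distrib, ← Finset.mul_sum, hS, Finset.sum_const,
        Finset.card_univ, Fintype.card_fin, nsmul_eq_mul]
      field_simp
      ring
  rw [IsMLEstimate, isMaxOn_univ_iff]
  constructor
  · intro h
    have h1 := h m
    rw [key θ] at h1
    have h2 : ω.1 / (2 * v) * (θ - m) ^ 2 ≤ 0 := by linarith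
    have h3 : (θ - m) ^ 2 ≤ 0 := nonpos_of_mul_nonpos_right h2 (by positivity)
    exact sub_eq_zero.1 (pow_eq_zero_iff two_ne_zero |>.1 (le_antisymm h3 (sq_nonneg _)))
  · rintro rfl x
    rw [key x]
    exact sub_le_self _ (by positivity)

lemma mean_sub_eq {ω : TimeStamps} (hω : 0 < ω.1) (θ : ℝ) :
    (∑ j, ω.2 j) / ω.1 - θ = (∑ j, (ω.2 j - θ)) / ω.1 := by
  have hM : (ω.1 : ℝ) ≠ 0 := by exact_mod_cast hω.ne'
  rw [Finset.sum_sub_distrib, Finset.sum_const, Finset.card_univ, Fintype.card_fin, nsmul_eq_mul]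
  field_simp

/-! ### Mean squared errors -/

lemma integral_sq_firstOrderML {a : ℝ} (ha : 0 < a) {v : NNReal} (hv : v ≠ 0) (θ : ℝ) :
    Integrable (fun ω => (firstOrderML (fun θ t => a * gaussianPDFReal θ v t) θ ω - θ) ^ 2)
        (poissonLaw fun t => a * gaussianPDFReal θ v t) ∧
      ∫ ω, (firstOrderML (fun θ t => a * gaussianPDFReal θ v t) θ ω - θ) ^ 2
        ∂(poissonLaw fun t => a * gaussianPDFReal θ v t) = v / a := by
  simp only [firstOrderML_gaussian ha hv, add_sub_cancel_left, div_pow]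
  refine integral_poissonLaw_gaussian ha.le θ hv (m := fun M => M * v / a ^ 2)
    (fun ω => by positivity)
    (fun M => (integrable_integral_sq_centredSum θ v M).1.div_const _) (fun M => ?_) ?_
  · rw [integral_div, (integrable_integral_sq_centredSum θ v M).2]
  · convert! (hasSum_poissonWeight_mul_nat a).mul_right (v / a ^ 2 : ℝ) using 1
    · funext M
      ring
    · field_simp

/-- The expected inverse number of stamps, on the event that there is one. -/
noncomputable def meanInverseCount (a : ℝ) : ℝ := ∑' M : ℕ, poissonWeight a M * (M : ℝ)⁻¹

/-- The convention `0⁻¹ = 0` removes the empty record, and the other inverses are at most `1`. -/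
lemma hasSum_meanInverseCount {a : ℝ} (ha : 0 ≤ a) :
    HasSum (fun M : ℕ => poissonWeight a M * (M : ℝ)⁻¹) (meanInverseCount a) := by
  refine Summable.hasSum (Summable.of_nonneg_of_le (fun M => ?_) (fun M => ?_)
    (hasSum_poissonWeight a).summable)
  · have := poissonWeight_nonneg ha M
    positivity
  · exact mul_le_of_le_one_right (poissonWeight_nonneg ha M) (Nat.cast_inv_le_one M)

/-- `1/M` is compared with `1/(M+1) + 3/((M+1)(M+2))`, whose Poisson means are explicit. The
constant `3` gives equality at `M = 1`. -/
lemma meanInverseCount_le {a : ℝ} (ha : 0 < a) : a * meanInverseCount a ≤ 1 + 3 / a := by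
  have h := hasSum_le (fun M => ?_) (hasSum_meanInverseCount ha.le)
    ((hasSum_poissonWeight_div_succ ha.ne').add
      ((hasSum_poissonWeight_div_succ_succ ha.ne').mul_left 3))
  · have e : 0 < Real.exp (-a) := Real.exp_pos _
    calc a * meanInverseCount a ≤ a * _ := mul_le_mul_of_nonneg_left h ha.le
      _ = (1 - Real.exp (-a)) + 3 / a * (1 - Real.exp (-a) * (1 + a)) := by field_simp
      _ ≤ 1 + 3 / a * 1 := by
        gcongr
        · linarith
        · have : 0 < Real.exp (-a) * (1 + a) := by positivity
          linarith
      _ = _ := by rw [mul_one]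
  · have hw := poissonWeight_nonneg ha.le M
    have : (M : ℝ)⁻¹ ≤ 1 / ((M : ℝ) + 1) + 3 * (1 / (((M : ℝ) + 1) * (M + 2))) := by
      rcases Nat.eq_zero_or_pos M with rfl | hM
      · norm_num
      · have h1 : (1 : ℝ) ≤ M := by exact_mod_cast hM
        rw [← sub_nonneg]
        have : 1 / ((M : ℝ) + 1) + 3 * (1 / (((M : ℝ) + 1) * (M + 2))) - (M : ℝ)⁻¹ =
            2 * (M - 1) / (M * (M + 1) * (M + 2)) := by
          field_simp
          ring
        rw [this]
        exact div_nonneg (by linarith) (by positivity)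
    calc _ ≤ poissonWeight a M * _ := mul_le_mul_of_nonneg_left this hw
      _ = _ := by ring

/-- Here `1/(M+1) ≤ 1/M` for `M ≥ 1`; the term `M = 0`, of weight `e^{-a}`, has to be subtracted. -/
lemma le_meanInverseCount {a : ℝ} (ha : 0 < a) :
    1 - Real.exp (-a) - a * Real.exp (-a) ≤ a * meanInverseCount a := by
  have h := hasSum_le (fun M => ?_) ((hasSum_poissonWeight_div_succ ha.ne').sub
    (hasSum_ite_eq 0 (Real.exp (-a)))) (hasSum_meanInverseCount ha.le)
  · calc _ = a * ((1 - Real.exp (-a)) / a - Real.exp (-a)) := by field_simp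
      _ ≤ _ := mul_le_mul_of_nonneg_left h ha.le
  · rcases Nat.eq_zero_or_pos M with rfl | hM
    · simp [poissonWeight_zero]
    · rw [if_neg hM.ne', sub_zero, one_div]
      have h1 : (0 : ℝ) < M := by exact_mod_cast hM
      gcongr
      · exact poissonWeight_nonneg ha.le M
      · linarith

lemma tendsto_mul_exp_neg : Tendsto (fun a : ℝ => a * Real.exp (-a)) atTop (𝓝 0) := by
  simpa using Real.tendsto_pow_mul_exp_neg_atTop_nhds_zero 1

lemma tendsto_mul_meanInverseCount :
    Tendsto (fun a => a * meanInverseCount a) atTop (𝓝 1) := by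
  have h1 : Tendsto (fun a : ℝ => 1 - Real.exp (-a) - a * Real.exp (-a)) atTop (𝓝 1) := by
    simpa using (tendsto_const_nhds.sub Real.tendsto_exp_neg_atTop_nhds_zero).sub
      tendsto_mul_exp_neg
  have h2 : Tendsto (fun a : ℝ => 1 + 3 / a) atTop (𝓝 1) := by
    simpa using tendsto_const_nhds.add (tendsto_const_nhds.div_atTop (tendsto_id (α := ℝ)))
  refine tendsto_of_tendsto_of_tendsto_of_le_of_le' h1 h2 ?_ ?_
  · filter_upwards [eventually_gt_atTop 0] with a ha using le_meanInverseCount ha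
  · filter_upwards [eventually_gt_atTop 0] with a ha using meanInverseCount_le ha

/-- Measurability of `est` comes for free: it is the sample mean when `M ≥ 1`, and there is only one
empty record. -/
lemma integral_sq_mlEstimate {a : ℝ} (ha : 0 < a) {v : NNReal} (hv : v ≠ 0) (θ : ℝ)
    {est : TimeStamps → ℝ} (hest : ∀ ω : TimeStamps, 0 < ω.1 →
      IsMLEstimate (fun θ t => a * gaussianPDFReal θ v t) ω (est ω)) :
    Integrable (fun ω => (est ω - θ) ^ 2) (poissonLaw fun t => a * gaussianPDFReal θ v t) ∧
      ∫ ω, (est ω - θ) ^ 2 ∂(poissonLaw fun t => a * gaussianPDFReal θ v t) =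
        v * meanInverseCount a + Real.exp (-a) * (est ⟨0, Fin.elim0⟩ - θ) ^ 2 := by
  have h0 : ∀ t : Fin 0 → ℝ, est ⟨0, t⟩ = est ⟨0, Fin.elim0⟩ := fun t => by
    rw [Subsingleton.elim t Fin.elim0]
  have hp : ∀ (M : ℕ) (t : Fin (M + 1) → ℝ),
      (est ⟨M + 1, t⟩ - θ) ^ 2 = (∑ j, (t j - θ)) ^ 2 / ((M + 1 : ℕ) : ℝ) ^ 2 := fun M t => by
    rw [(isMLEstimate_gaussian_iff ha hv (ω := ⟨M + 1, t⟩) M.succ_pos _).1 (hest _ M.succ_pos),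
      mean_sub_eq (ω := ⟨M + 1, t⟩) M.succ_pos, div_pow]
  refine integral_poissonLaw_gaussian ha.le θ hv
    (m := fun M => if M = 0 then (est ⟨0, Fin.elim0⟩ - θ) ^ 2 else v * (M : ℝ)⁻¹)
    (fun ω => sq_nonneg _) (fun M => ?_) (fun M => ?_) ?_
  · cases M with
    | zero => simp only [h0]; exact integrable_const _
    | succ M => simp only [hp]; exact (integrable_integral_sq_centredSum θ v _).1.div_const _
  · cases M with
    | zero => simp [h0]
    | succ M =>
      simp only [hp]
      rw [integral_div, (integrable_integral_sq_centredSum θ v _).2, if_neg M.succ_ne_zero]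
      field_simp
  · convert! ((hasSum_meanInverseCount ha.le).mul_left (v : ℝ)).add
      (hasSum_ite_eq 0 (Real.exp (-a) * (est ⟨0, Fin.elim0⟩ - θ) ^ 2)) using 1
    funext M
    split_ifs with hM
    · subst hM
      simp [poissonWeight_zero]
    · ring

/-! ### The total variance -/

lemma effectivePulse_eq_gaussian {N : ℕ} (hN : 0 < N) (α₀ : ℝ) {σt : ℝ} (hσt : 0 < σt)
    (τ : Plane → ℝ) (p : Fin N × Fin N) :
    effectivePulse N α₀ σt τ p =
      fun θ t => α₀ / (N : ℝ) ^ 2 * gaussianPDFReal θ (pulseVariance N σt τ p) t :=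
  funext fun θ => funext fun t => effectivePulse_eq hN α₀ hσt τ p θ t

lemma totalVariance_eq {N : ℕ} (hN : 0 < N) {α₀ : ℝ} (hα : 0 < α₀) {σt : ℝ} (hσt : 0 < σt)
    (τ : Plane → ℝ) {est : Fin N × Fin N → TimeStamps → ℝ} {V : Fin N × Fin N → ℝ}
    (h : ∀ p, Integrable (fun ω => (est p ω - τ (center N p)) ^ 2)
        (poissonLaw (effectivePulse N α₀ σt τ p (τ (center N p)))) ∧
      ∫ ω, (est p ω - τ (center N p)) ^ 2
        ∂(poissonLaw (effectivePulse N α₀ σt τ p (τ (center N p)))) = V p) :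
    totalVariance N α₀ σt τ est = 1 / (N : ℝ) ^ 2 * ∑ p, V p := by
  have : ∀ p, IsProbabilityMeasure (poissonLaw (effectivePulse N α₀ σt τ p (τ (center N p)))) :=
    fun p => by
      rw [effectivePulse_eq_gaussian hN α₀ hσt]
      exact isProbabilityMeasure_poissonLaw_gaussian (by positivity) _
        (pulseVariance_ne_zero N hσt τ p)
  unfold totalVariance dataLaw
  simp only [integral_sq_piecewiseConstant_sub hN, pixelMean_eq hN]
  rw [integral_const_mul]
  congr 1
  rw [integral_finsetSum Finset.univ
    (f := fun p (ω : Fin N × Fin N → TimeStamps) => (est p (ω p) - τ (center N p)) ^ 2)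
    fun p _ => integrable_comp_eval (X := fun _ => TimeStamps)
      (f := fun ω => (est p ω - τ (center N p)) ^ 2) (h p).1]
  refine Finset.sum_congr rfl fun p _ => ?_
  rw [← (h p).2]
  exact integral_comp_eval (X := fun _ => TimeStamps) (f := fun ω => (est p ω - τ (center N p)) ^ 2)
    (h p).1.aestronglyMeasurable

lemma meanSqGradient_mul_add {N : ℕ} (hN : 0 < N) (σt : ℝ) (τ : Plane → ℝ) :
    meanSqGradient N τ * spatialStd N ^ 2 + σt ^ 2 =
      1 / (N : ℝ) ^ 2 * ∑ p, (pulseVariance N σt τ p : ℝ) := by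
  have hN' : (N : ℝ) ≠ 0 := by exact_mod_cast hN.ne'
  simp only [coe_pulseVariance, Finset.sum_add_distrib, ← Finset.sum_mul, Finset.sum_const,
    Finset.card_univ, Fintype.card_prod, Fintype.card_fin, nsmul_eq_mul, meanSqGradient]
  push_cast
  field_simp

end SpadLidar

open SpadLidar
theorem mainTheorem6 (N : ℕ) (hN : 0 < N) (σt : ℝ) (hσt : 0 < σt) (τ : Plane → ℝ)
    (hτ : ∀ p : Fin N × Fin N, DifferentiableAt ℝ τ (center N p)) :
    (∀ α₀ : ℝ, 0 < α₀ →
      totalVariance N α₀ σt τ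
          (fun p => firstOrderML (effectivePulse N α₀ σt τ p) (τ (center N p))) =
        (N : ℝ) ^ 2 / α₀ * (meanSqGradient N τ * spatialStd N ^ 2 + σt ^ 2)) ∧
    (∀ α₀ : ℝ, 0 < α₀ → ∀ (p : Fin N × Fin N) (ω : TimeStamps), 0 < ω.1 →
      ∃! θ : ℝ, IsMLEstimate (effectivePulse N α₀ σt τ p) ω θ) ∧
    (∀ (est : ℝ → Fin N × Fin N → TimeStamps → ℝ) (B : ℝ),
      (∀ α₀ : ℝ, 0 < α₀ → ∀ (p : Fin N × Fin N) (ω : TimeStamps), 0 < ω.1 →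
        IsMLEstimate (effectivePulse N α₀ σt τ p) ω (est α₀ p ω)) →
      (∀ α₀ : ℝ, 0 < α₀ → ∀ (p : Fin N × Fin N) (ω : TimeStamps), ω.1 = 0 →
        |est α₀ p ω| ≤ B) →
      Tendsto
        (fun α₀ : ℝ => totalVariance N α₀ σt τ (est α₀) /
          ((N : ℝ) ^ 2 / α₀ * (meanSqGradient N τ * spatialStd N ^ 2 + σt ^ 2)))
        atTop (𝓝 1)) := by
  have hN' : (0 : ℝ) < N := by exact_mod_cast hN
  have hv := pulseVariance_ne_zero N hσt τ
  have hpulse := fun α₀ => effectivePulse_eq_gaussian hN α₀ hσt τ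
  refine ⟨fun α₀ hα => ?_, fun α₀ hα p ω hω => ?_, fun est B hest hB => ?_⟩
  · have ha : 0 < α₀ / (N : ℝ) ^ 2 := by positivity
    rw [totalVariance_eq hN hα hσt τ (V := fun p => pulseVariance N σt τ p / (α₀ / (N : ℝ) ^ 2))
      fun p => by rw [hpulse]; exact integral_sq_firstOrderML ha (hv p) _,
      meanSqGradient_mul_add hN, ← Finset.sum_div]
    field_simp
  · have ha : 0 < α₀ / (N : ℝ) ^ 2 := by positivity
    rw [hpulse]
    exact ⟨_, (isMLEstimate_gaussian_iff ha (hv p) hω _).2 rfl,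
      fun θ hθ => (isMLEstimate_gaussian_iff ha (hv p) hω θ).1 hθ⟩
  · set S : ℝ := ∑ p, (pulseVariance N σt τ p : ℝ) with hSdef
    have hS : 0 < S := by
      have : Nonempty (Fin N × Fin N) := ⟨(⟨0, hN⟩, ⟨0, hN⟩)⟩
      refine Finset.sum_pos (fun p _ => ?_) Finset.univ_nonempty
      have := hv p
      positivity
    set D : ℝ → ℝ := fun α₀ => ∑ p, (est α₀ p ⟨0, Fin.elim0⟩ - τ (center N p)) ^ 2 with hDdef
    have hD0 : ∀ α₀, 0 ≤ D α₀ := fun α₀ => Finset.sum_nonneg fun p _ => sq_nonneg _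
    have hDB : ∀ α₀, 0 < α₀ → D α₀ ≤ ∑ p : Fin N × Fin N, (B + |τ (center N p)|) ^ 2 :=
      fun α₀ hα => Finset.sum_le_sum fun p _ => sq_le_sq'
        (by linarith [neg_abs_le (est α₀ p ⟨0, Fin.elim0⟩), hB α₀ hα p ⟨0, Fin.elim0⟩ rfl,
          le_abs_self (τ (center N p))])
        (by linarith [le_abs_self (est α₀ p ⟨0, Fin.elim0⟩), hB α₀ hα p ⟨0, Fin.elim0⟩ rfl,
          neg_abs_le (τ (center N p))])
    have hlim : Tendsto (fun α₀ : ℝ => α₀ / (N : ℝ) ^ 2) atTop atTop :=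
      tendsto_id.atTop_div_const (by positivity)
    -- The contribution of the empty records, relative to the claimed variance: `D` stays bounded as
    -- the flux grows, while `a e^{-a}` tends to `0`.
    have hzero : Tendsto (fun α₀ : ℝ => α₀ / (N : ℝ) ^ 2 * Real.exp (-(α₀ / (N : ℝ) ^ 2)) *
        (D α₀ / S)) atTop (𝓝 0) := by
      have hb := (tendsto_mul_exp_neg.comp hlim).mul_const
        ((∑ p : Fin N × Fin N, (B + |τ (center N p)|) ^ 2) / S)
      rw [zero_mul] at hb
      refine tendsto_of_tendsto_of_tendsto_of_le_of_le' tendsto_const_nhds hb ?_ ?_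
      · filter_upwards [eventually_gt_atTop 0] with α₀ hα
        have := hD0 α₀
        positivity
      · filter_upwards [eventually_gt_atTop 0] with α₀ hα
        have := hDB α₀ hα
        simp only [Function.comp]
        gcongr
    have hsum := (tendsto_mul_meanInverseCount.comp hlim).add hzero
    rw [add_zero] at hsum
    -- For `α₀ > 0` the ratio equals `a 𝔼[1/M; M ≥ 1] + a e^{-a} D / S` exactly.
    refine hsum.congr' ?_
    filter_upwards [eventually_gt_atTop 0] with α₀ hα
    have ha : 0 < α₀ / (N : ℝ) ^ 2 := by positivity
    rw [totalVariance_eq hN hα hσt τ fun p => by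
        rw [hpulse]
        exact integral_sq_mlEstimate ha (hv p) _ fun ω hω => hpulse α₀ p ▸ hest α₀ hα p ω hω,
      meanSqGradient_mul_add hN, Finset.sum_add_distrib, ← Finset.sum_mul, ← Finset.mul_sum]
    simp only [Function.comp, ← hSdef]
    change _ = 1 / (N : ℝ) ^ 2 * (S * _ + _ * D α₀) / _
    field_simp
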